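/- Let $q = p^r$ be a prime power ($p$ prime, $r \ge 1$), and let $\overline{\mathbb{Q}}$ be an algebraic closure of $\mathbb{Q}$. A $q$-Weil number of weight one is an algebraic integer $\alpha \in \overline{\mathbb{Q}}$ such that $|\sigma(\alpha)| = q^{1/2}$ for every embedding $\sigma : \overline{\mathbb{Q}} \hookrightarrow \mathbb{C}$. Let $\Gamma \subset \overline{\mathbb{Q}}^*$ be the multiplicative subgroup generated by all $q$-Weil numbers of weight one. Then $\Gamma$ has infinite rank as an abelian group, that is, $\dim_{\mathbb{Q}}(\Gamma \otimes_{\mathbb{Z}} \mathbb{Q}) = \infty$; equivalently, $\Gamma$ contains arbitrarily large finite families of multiplicatively independent elements. -/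

import Mathlib

/-- `α` is a `q`-Weil number of weight `w`: an algebraic integer all of whose complex
absolute values (under all embeddings of `ℚ̄` into `ℂ`) are equal to `q ^ (w / 2)`. -/
def IsWeilNumber (q w : ℕ) (α : AlgebraicClosure ℚ) : Prop :=
  IsIntegral ℤ α ∧ ∀ σ : AlgebraicClosure ℚ →+* ℂ, ‖σ α‖ = (q : ℝ) ^ ((w : ℝ) / 2)

/-- The subgroup of `ℚ̄ˣ` generated by the `q`-Weil numbers of weight `w`. -/
noncomputable def weilSubgroup (q w : ℕ) : Subgroup (AlgebraicClosure ℚ)ˣ :=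
  Subgroup.closure {u : (AlgebraicClosure ℚ)ˣ | IsWeilNumber q w (u : AlgebraicClosure ℚ)}

open Polynomial IntermediateField


/-! Take real cyclotomic integers `β n = ζ n + (ζ n)⁻¹` with `β (n+1) ^ 3 - 3 * β (n+1) = β n`, `β 0
= 1`, and let `α n` be a root of `x² - β n x + q`. As `(β n)² ≤ 4 < 4q` under every embedding, `α n`
is a Weil number.

Fix a `p`-adic absolute value on `ℚ̄` and send `u` to the function `σ ↦ log |σ u|`. All conjugates
of `β n` are `p`-adic units, so `α n` gives a function with values in `{0, log |q|}`. A
finite-dimensional space holds finitely many functions with values in a finite set, so it suffices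
that infinitely many of these functions are distinct
(`AddMonoidHom.aleph0_le_rank_of_infinite_range`).

For `n < m`, a Galois element over `L = ℚ((β m)²)` that moves exactly one of the square roots of `(β
n)² - 4q`, `(β m)² - 4q` separates them (`exists_algEquiv_separating_sqrt`). If there is none, the
product of these roots lies in `L`, which has odd degree `3 ^ m`; taking norms to `ℚ` makes the
product of the `n`-th and `m`-th terms of `sqTripling^[n] (4q) - 1` a square
(`isSquare_of_mul_mem_adjoin_tower`). `exists_infinite_not_isSquare_mul` excludes this on an
infinite set of indices. -/

/-- The cubic `y ↦ y (y - 3)²`, which sends `β²` to `(β³ - 3β)²`. -/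
def sqTripling {R : Type*} [CommRing R] (y : R) : R := y * (y - 3) ^ 2

theorem map_iterate_sqTripling {R S : Type*} [CommRing R] [CommRing S] (f : R →+* S) (n : ℕ)
    (x : R) : f (sqTripling^[n] x) = sqTripling^[n] (f x) := by
  induction n generalizing x with
  | zero => rfl
  | succ n ih => rw [Function.iterate_succ_apply, Function.iterate_succ_apply, ih]; simp [sqTripling, map_ofNat]

/-! ### Square classes along an integer orbit -/

/-- If `M = s²`, the next term `9 s⁶ - 9 s⁴ + 1` is not a square. -/
theorem not_isSquare_nine_mul_pow {s : ℤ} (hs : 2 ≤ s) : ¬ IsSquare (9 * s ^ 6 - 9 * s ^ 4 + 1) := by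
  rintro ⟨t, ht⟩
  wlog h0 : 0 ≤ t generalizing t
  · exact this (-t) (by linarith) (by linarith)
  -- Completing the square puts `2 * t` strictly between the consecutive integers `a - 1` and `a`.
  set a := 6 * s ^ 3 - 3 * s with ha
  have e : (2 * t) ^ 2 = a ^ 2 - (9 * s ^ 2 - 4) := by rw [ha]; linarith
  have h3 : 4 * s ≤ s ^ 3 := by nlinarith [mul_nonneg (by linarith : (0:ℤ) ≤ s) (by nlinarith : (0:ℤ) ≤ s ^ 2 - 4)]
  have h3' : 2 * s ^ 2 ≤ s ^ 3 := by nlinarith [sq_nonneg s]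
  have h4 : 0 < a := by rw [ha]; linarith
  have h1 : 2 * t < a := by
    apply lt_of_pow_lt_pow_left₀ 2 h4.le
    nlinarith
  have h2 : a - 1 < 2 * t := by
    apply lt_of_pow_lt_pow_left₀ 2 (by linarith)
    nlinarith
  omega

theorem eight_le_iterate_sqTripling {x : ℤ} (hx : 8 ≤ x) (n : ℕ) : 8 ≤ sqTripling^[n] x := by
  induction n with
  | zero => exact hx
  | succ n ih =>
    rw [Function.iterate_succ_apply']
    generalize sqTripling^[n] x = y at ih
    have h : 0 ≤ (y - 3) ^ 2 - 1 := by nlinarith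
    unfold sqTripling
    nlinarith [mul_nonneg (by linarith : (0 : ℤ) ≤ y) h]

theorem four_dvd_iterate_sqTripling {x : ℤ} (hx : 4 ∣ x) (n : ℕ) : 4 ∣ sqTripling^[n] x := by
  induction n with
  | zero => exact hx
  | succ n ih =>
    rw [Function.iterate_succ_apply']
    exact Dvd.dvd.mul_right ih _

theorem iterate_sqTripling_modEq {k a b : ℤ} (h : a ≡ b [ZMOD k]) (n : ℕ) :
    sqTripling^[n] a ≡ sqTripling^[n] b [ZMOD k] := by
  induction n with
  | zero => exact h
  | succ n ih =>
    rw [Function.iterate_succ_apply', Function.iterate_succ_apply']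
    exact ih.mul ((ih.sub_right 3).pow 2)

/-- Modulo 3 the cubic is `y ^ 3`, which is the identity on `ZMod 3`. -/
theorem iterate_sqTripling_modEq_three (x : ℤ) (n : ℕ) : sqTripling^[n] x ≡ x [ZMOD 3] := by
  refine (ZMod.intCast_eq_intCast_iff _ _ 3).1 ?_
  have h := map_iterate_sqTripling (Int.castRingHom (ZMod 3)) n x
  have hid : ∀ y : ZMod 3, sqTripling y = y := by unfold sqTripling; decide
  rw [Function.iterate_fixed (hid _)] at h
  exact h

/-- After passing through `1` modulo `k`, the orbit stays at `4` modulo `k`. -/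
theorem iterate_sqTripling_sub_one_modEq (x : ℤ) {n m : ℕ} (h : n < m) :
    sqTripling^[m] x - 1 ≡ 3 [ZMOD sqTripling^[n] x - 1] := by
  obtain ⟨k, rfl⟩ := Nat.exists_eq_add_of_lt h
  rw [show n + k + 1 = k + 1 + n by ring, Function.iterate_add_apply]
  have h1 : sqTripling^[n] x ≡ 1 [ZMOD sqTripling^[n] x - 1] :=
    (Int.modEq_iff_dvd.2 (dvd_refl _)).symm
  have h4 : sqTripling^[k + 1] (1 : ℤ) = 4 := by
    rw [Function.iterate_succ_apply, show sqTripling (1 : ℤ) = 4 by norm_num [sqTripling],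
      Function.iterate_fixed (by norm_num [sqTripling])]
  have h2 := (iterate_sqTripling_modEq h1 (k + 1)).sub_right 1
  rwa [h4, show (4 : ℤ) - 1 = 3 by norm_num] at h2

theorem isSquare_of_isCoprime_of_isSquare_mul {a b : ℤ} (ha : 0 ≤ a) (hab : IsCoprime a b)
    (h : IsSquare (a * b)) : IsSquare a := by
  obtain ⟨c, hc⟩ := h
  obtain ⟨d, hd | hd⟩ := Int.sq_of_isCoprime hab (hc.trans (sq c).symm)
  · exact ⟨d, hd.trans (sq d)⟩
  · have : d = 0 := by nlinarith [sq_nonneg d]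
    exact ⟨0, by rw [hd, this]; norm_num⟩

/-- The orbit of `4 q`, shifted by one, meets infinitely many square classes. -/
theorem exists_infinite_not_isSquare_mul {q : ℤ} (hq : 2 ≤ q) :
    ∃ S : Set ℕ, S.Infinite ∧ ∀ n ∈ S, ∀ m ∈ S, n < m →
      ¬ IsSquare ((sqTripling^[n] (4 * q) - 1) * (sqTripling^[m] (4 * q) - 1)) := by
  have h8 := eight_le_iterate_sqTripling (x := 4 * q) (by linarith)
  by_cases h3 : q % 3 = 1
  -- Here 3 divides every shifted term; the quotients `M n` are pairwise coprime, and no two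
  -- consecutive ones are squares.
  · have hd : ∀ n, ∃ M : ℤ, sqTripling^[n] (4 * q) - 1 = 3 * M := fun n => by
      have h := iterate_sqTripling_modEq_three (4 * q) n
      unfold Int.ModEq at h
      exact ⟨(sqTripling^[n] (4 * q) - 1) / 3, by omega⟩
    choose M hM using hd
    have hcop : ∀ {n m : ℕ}, n < m → IsCoprime (M n) (M m) := fun {n m} h => by
      obtain ⟨c, hc⟩ := Int.modEq_iff_dvd.1 (iterate_sqTripling_sub_one_modEq (4 * q) h)
      rw [hM, hM] at hc
      exact ⟨c, 1, by linarith⟩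
    have hnext : ∀ n, IsSquare (M n) → ¬ IsSquare (M (n + 1)) := by
      rintro n ⟨s, hs⟩
      wlog h0 : 0 ≤ s generalizing s
      · exact this (-s) (by rw [hs]; ring) (by linarith)
      have h2 : 2 ≤ s := by
        by_contra hlt
        have : s = 0 ∨ s = 1 := by omega
        have h1 := h8 n
        have h2 := hM n
        rcases this with rfl | rfl <;> omega
      have e1 : sqTripling^[n] (4 * q) = 3 * s ^ 2 + 1 := by linarith [hM n, hs]
      have e2 := hM (n + 1)
      rw [Function.iterate_succ_apply', e1, sqTripling] at e2
      rw [show M (n + 1) = 9 * s ^ 6 - 9 * s ^ 4 + 1 by linarith]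
      exact not_isSquare_nine_mul_pow h2
    refine ⟨{n | ¬ IsSquare (M n)}, ?_, fun n hn m hm hnm hsq => hn ?_⟩
    · rw [Set.infinite_iff_exists_gt]
      intro a
      by_cases h : IsSquare (M (a + 1))
      · exact ⟨a + 2, hnext _ h, by omega⟩
      · exact ⟨a + 1, h, by omega⟩
    · refine isSquare_of_isCoprime_of_isSquare_mul (by linarith [h8 n, hM n]) (hcop hnm) ?_
      rw [hM, hM] at hsq
      obtain ⟨c, hc⟩ := hsq
      have h3c : (3 : ℤ) ∣ c := by
        refine Int.prime_three.dvd_of_dvd_pow (n := 2) ⟨3 * (M n * M m), ?_⟩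
        linarith
      obtain ⟨d, rfl⟩ := h3c
      exact ⟨d, by linarith⟩
  -- Here 3 divides no shifted term, so the terms are pairwise coprime; each is `-1` modulo 4, hence
  -- not a square.
  · refine ⟨Set.univ, Set.infinite_univ, fun n _ m _ hnm hsq => ?_⟩
    have hcop : IsCoprime (sqTripling^[n] (4 * q) - 1) (sqTripling^[m] (4 * q) - 1) := by
      obtain ⟨c, hc⟩ := Int.modEq_iff_dvd.1 (iterate_sqTripling_sub_one_modEq (4 * q) hnm)
      have h3' : IsCoprime (sqTripling^[n] (4 * q) - 1) 3 := by
        refine ((Int.prime_three.coprime_iff_not_dvd).2 ?_).symm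
        have h := iterate_sqTripling_modEq_three (4 * q) n
        unfold Int.ModEq at h
        omega
      obtain ⟨u, v, huv⟩ := h3'
      exact ⟨u + v * c, v, by linear_combination huv - v * hc⟩
    obtain ⟨c, hc⟩ := isSquare_of_isCoprime_of_isSquare_mul (by linarith [h8 n]) hcop hsq
    obtain ⟨e, he⟩ := four_dvd_iterate_sqTripling (Dvd.intro q rfl : (4 : ℤ) ∣ 4 * q) n
    rcases Int.even_or_odd' c with ⟨d, rfl | rfl⟩
    · have : 4 * (d * d) = 4 * e - 1 := by linarith
      omega
    · have : 4 * (d * d + d) + 1 = 4 * e - 1 := by linarith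
      omega

/-! ### Irreducibility of the iterates -/

/-- The integral polynomial `sqTripling^[n] X - 1`. -/
noncomputable def orbitPoly (n : ℕ) : ℤ[X] := sqTripling^[n] X - 1

theorem aeval_orbitPoly {R : Type*} [CommRing R] (n : ℕ) (x : R) :
    aeval x (orbitPoly n) = sqTripling^[n] x - 1 := by
  have h := map_iterate_sqTripling (aeval x : ℤ[X] →ₐ[ℤ] R).toRingHom n X
  simp only [AlgHom.toRingHom_eq_coe, RingHom.coe_coe, aeval_X] at h
  simp [orbitPoly, h]

theorem monic_natDegree_iterate_sqTripling (n : ℕ) :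
    (sqTripling^[n] (X : ℤ[X])).Monic ∧ (sqTripling^[n] (X : ℤ[X])).natDegree = 3 ^ n := by
  induction n with
  | zero => exact ⟨monic_X, natDegree_X⟩
  | succ n ih =>
    rw [Function.iterate_succ_apply']
    set P := sqTripling^[n] (X : ℤ[X])
    have hd : (3 : ℤ[X]).degree < P.degree := by
      rw [show (3 : ℤ[X]) = C 3 from rfl]
      refine degree_C_le.trans_lt ?_
      rw [degree_eq_natDegree ih.1.ne_zero, ih.2]
      exact_mod_cast pow_pos (by norm_num) n
    have hm : (P - 3).Monic := ih.1.sub_of_left hd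
    have hn : (P - 3).natDegree = 3 ^ n := by
      rw [show (3 : ℤ[X]) = C 3 from rfl, natDegree_sub_C, ih.2]
    refine ⟨ih.1.mul (hm.pow 2), ?_⟩
    rw [sqTripling, ih.1.natDegree_mul (hm.pow 2), hm.natDegree_pow, hn, ih.2]
    ring

theorem natDegree_orbitPoly (n : ℕ) : (orbitPoly n).natDegree = 3 ^ n := by
  rw [orbitPoly, ← C_1, natDegree_sub_C, (monic_natDegree_iterate_sqTripling n).2]

theorem monic_orbitPoly (n : ℕ) : (orbitPoly n).Monic := by
  refine (monic_natDegree_iterate_sqTripling n).1.sub_of_left ?_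
  rw [degree_one, degree_eq_natDegree (monic_natDegree_iterate_sqTripling n).1.ne_zero,
    (monic_natDegree_iterate_sqTripling n).2]
  exact_mod_cast pow_pos (by norm_num) n

theorem map_orbitPoly_zmod_three (n : ℕ) :
    (orbitPoly n).map (Int.castRingHom (ZMod 3)) = (X - 1) ^ 3 ^ n := by
  have h : sqTripling^[n] (X : (ZMod 3)[X]) = X ^ 3 ^ n := by
    induction n with
    | zero => simp
    | succ n ih =>
      rw [Function.iterate_succ_apply', ih, sqTripling,
        show (3 : (ZMod 3)[X]) = 0 from CharP.cast_eq_zero _ 3]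
      ring
  have h' := map_iterate_sqTripling (mapRingHom (Int.castRingHom (ZMod 3))) n X
  simp only [coe_mapRingHom, map_X] at h'
  rw [orbitPoly, Polynomial.map_sub, h', h, Polynomial.map_one, sub_pow_char_pow, one_pow]

/-- Eisenstein at 3 around `X = 1`: the reduction is `(X - 1) ^ 3 ^ n`, and for positive `n` the
value at 1 is `4 - 1 = 3`, not divisible by 9. -/
theorem irreducible_orbitPoly (n : ℕ) : Irreducible (orbitPoly n) := by
  rcases n with _ | n
  · simpa [orbitPoly] using irreducible_X_sub_C (1 : ℤ)
  have : Fact (Nat.Prime 3) := ⟨Nat.prime_three⟩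
  refine generalizedEisenstein (K := ZMod 3) (q := X - C 1) (p := 3 ^ (n + 1)) ?_
    (monic_X_sub_C 1) (monic_orbitPoly _).isPrimitive ?_ ?_ ?_ ?_
  · simpa using irreducible_X_sub_C (1 : ZMod 3)
  · rw [natDegree_orbitPoly]; positivity
  · simp [(monic_orbitPoly _).leadingCoeff]
  · simpa [(monic_orbitPoly _).leadingCoeff] using map_orbitPoly_zmod_three (n + 1)
  · have h3 : (orbitPoly (n + 1)).eval 1 = 3 := by
      rw [← coe_aeval_eq_eval, aeval_orbitPoly, Function.iterate_succ_apply,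
        show sqTripling (1 : ℤ) = 4 by norm_num [sqTripling],
        Function.iterate_fixed (by norm_num [sqTripling])]
      norm_num
    rw [modByMonic_X_sub_C_eq_C_eval, h3, map_C, Ne, C_eq_zero, Ideal.Quotient.eq_zero_iff_mem]
    have hk : RingHom.ker (algebraMap ℤ (ZMod 3)) = Ideal.span {3} := by
      simpa using ZMod.ker_intCastRingHom 3
    rw [hk, Ideal.span_singleton_pow, Ideal.mem_span_singleton]
    norm_num
theorem minpoly_of_iterate_sqTripling_eq_one {L : Type*} [Field L] [Algebra ℚ L] {y : L} {n : ℕ}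
    (hy : sqTripling^[n] y = 1) :
    minpoly ℚ y = (orbitPoly n).map (algebraMap ℤ ℚ) := by
  refine (minpoly.eq_of_irreducible_of_monic ?_ ?_ ((monic_orbitPoly n).map _)).symm
  · exact ((monic_orbitPoly n).irreducible_iff_irreducible_map_fraction_map).1
      (irreducible_orbitPoly n)
  · rw [aeval_map_algebraMap, aeval_orbitPoly, hy, sub_self]

theorem norm_gen_algebraMap_sub {F L : Type*} [Field F] [Field L] [Algebra F L] {y : L}
    (hy : IsIntegral F y) (a : F) :
    Algebra.norm F (AdjoinSimple.gen F (algebraMap F L a - y)) = (minpoly F y).eval a := by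
  have hz : algebraMap F L a - y = -(y - algebraMap F L a) := by ring
  have hint : IsIntegral F (algebraMap F L a - y) := isIntegral_algebraMap.sub hy
  have h := Algebra.PowerBasis.norm_gen_eq_coeff_zero_minpoly (adjoin.powerBasis hint)
  rw [adjoin.powerBasis_gen] at h
  rw [h, adjoin.powerBasis_dim, minpoly_gen, coeff_zero_eq_eval_zero, hz, minpoly.neg,
    minpoly.sub_algebraMap, ← C_1, ← C_neg, ← C_pow, natDegree_C_mul (by simp), natDegree_comp]
  simp [natDegree_comp, ← mul_assoc, ← mul_pow]

/-- In an extension of odd degree, the norm of `a - y` is an odd power of the orbit value. -/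
theorem exists_odd_norm_sub {L : Type*} [Field L] [Algebra ℚ L] (hL : Odd (Module.finrank ℚ L))
    {y : L} {n : ℕ} (hy : sqTripling^[n] y = 1) (a : ℤ) :
    ∃ k, Odd k ∧
      Algebra.norm ℚ (algebraMap ℚ L a - y) = ((sqTripling^[n] a - 1 : ℤ) : ℚ) ^ k := by
  have hmin := minpoly_of_iterate_sqTripling_eq_one hy
  have hint : IsIntegral ℚ y := by
    rw [← minpoly.ne_zero_iff, hmin]
    exact ((monic_orbitPoly n).map _).ne_zero
  -- The exponent is the degree of `L` over the subfield generated by `a - y`; it divides an odd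
  -- number.
  refine ⟨Module.finrank ℚ⟮algebraMap ℚ L a - y⟯ L, ?_, ?_⟩
  · rw [← Module.finrank_mul_finrank ℚ ℚ⟮algebraMap ℚ L a - y⟯ L] at hL
    exact (Nat.odd_mul.1 hL).2
  · have h := map_iterate_sqTripling (Int.castRingHom ℚ) n a
    simp only [eq_intCast] at h
    rw [Algebra.norm_eq_norm_adjoin, norm_gen_algebraMap_sub hint, hmin, eval_map_algebraMap,
      aeval_orbitPoly, Int.cast_sub, h, Int.cast_one]

theorem isSquare_mul_of_isSquare_pow_mul_pow {a b : ℚ} {k l : ℕ} (hk : Odd k) (hl : Odd l)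
    (ha : a ≠ 0) (hb : b ≠ 0) (h : IsSquare (a ^ k * b ^ l)) : IsSquare (a * b) := by
  obtain ⟨i, rfl⟩ := hk
  obtain ⟨j, rfl⟩ := hl
  obtain ⟨c, hc⟩ := h
  refine ⟨c / (a ^ i * b ^ j), ?_⟩
  field_simp
  linear_combination hc

theorem isSquare_mul_of_isSquare_mul_sub {L : Type*} [Field L] [Algebra ℚ L]
    (hL : Odd (Module.finrank ℚ L)) {y z : L} {n m : ℕ} (hy : sqTripling^[n] y = 1)
    (hz : sqTripling^[m] z = 1) {a : ℤ} (ha : 8 ≤ a) 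
    (h : IsSquare ((algebraMap ℚ L a - y) * (algebraMap ℚ L a - z))) :
    IsSquare ((sqTripling^[n] a - 1) * (sqTripling^[m] a - 1)) := by
  obtain ⟨k, hk, hnk⟩ := exists_odd_norm_sub hL hy a
  obtain ⟨l, hl, hnl⟩ := exists_odd_norm_sub hL hz a
  have hsq := h.map (Algebra.norm ℚ)
  rw [map_mul, hnk, hnl] at hsq
  have hn := eight_le_iterate_sqTripling ha n
  have hm := eight_le_iterate_sqTripling ha m
  have := isSquare_mul_of_isSquare_pow_mul_pow hk hl
    (by exact_mod_cast (by linarith : 0 < sqTripling^[n] a - 1).ne')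
    (by exact_mod_cast (by linarith : 0 < sqTripling^[m] a - 1).ne') hsq
  rw [← Int.cast_mul] at this
  exact Rat.isSquare_intCast_iff.1 this

/-! ### Towers of real cyclotomic integers -/

theorem exists_root_of_unity_tower (K : Type*) [Field K] [IsAlgClosed K] :
    ∃ ζ : ℕ → K, ζ 0 ^ 2 - ζ 0 + 1 = 0 ∧ ∀ n, ζ (n + 1) ^ 3 = ζ n := by
  obtain ⟨z, hz⟩ := IsAlgClosed.exists_root (X ^ 2 - X + 1 : K[X]) (by
    rw [show (X ^ 2 - X + 1 : K[X]) = C 1 * X ^ 2 + C (-1) * X + C 1 by simp; ring,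
      degree_quadratic one_ne_zero]; decide)
  choose f hf using fun x : K => IsAlgClosed.exists_pow_nat_eq x (n := 3) (by norm_num)
  refine ⟨fun n => f^[n] z, by simpa [IsRoot] using hz, fun n => ?_⟩
  simp only [Function.iterate_succ_apply', hf]

/-- A tower `β₀ = 1`, `β_{n+1}³ - 3 β_{n+1} = β_n` of algebraic integers all of whose
conjugates lie in `[-2, 2]`. -/
theorem exists_tripling_tower (K : Type*) [Field K] [IsAlgClosed K] :
    ∃ β : ℕ → K, β 0 = 1 ∧ (∀ n, β (n + 1) ^ 3 - 3 * β (n + 1) = β n) ∧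
      (∀ n, IsIntegral ℤ (β n)) ∧
      ∀ n, ∀ τ : K →+* ℂ, ∃ b : ℝ, τ (β n) = b ∧ |b| ≤ 2 := by
  obtain ⟨ζ, h0, hs⟩ := exists_root_of_unity_tower K
  have hz : ∀ n, ζ n ≠ 0 := fun n => by
    induction n with
    | zero => intro h; simp [h] at h0
    | succ n ih => intro h; apply ih; rw [← hs, h]; simp
  have hp : ∀ n, ∃ k, k ≠ 0 ∧ ζ n ^ k = 1 := fun n => by
    induction n with
    | zero => exact ⟨6, by norm_num, by linear_combination (ζ 0 + 1) * (ζ 0 ^ 3 - 1) * h0⟩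
    | succ n ih =>
      obtain ⟨k, hk, h⟩ := ih
      exact ⟨3 * k, by omega, by rw [pow_mul, hs, h]⟩
  refine ⟨fun n => ζ n + (ζ n)⁻¹, ?_, fun n => ?_, fun n => ?_, fun n τ => ?_⟩
  · have := hz 0
    field_simp
    linear_combination h0
  · have := hz (n + 1)
    simp only [← hs n]
    field_simp
    ring
  · obtain ⟨k, hk, h⟩ := hp n
    exact (IsIntegral.of_pow (Nat.pos_of_ne_zero hk) (h ▸ isIntegral_one)).add
      (IsIntegral.of_pow (Nat.pos_of_ne_zero hk) (by rw [inv_pow, h, inv_one]; exact isIntegral_one))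
  · obtain ⟨k, hk, h⟩ := hp n
    have hnorm : ‖τ (ζ n)‖ = 1 := Complex.norm_eq_one_of_pow_eq_one (by rw [← map_pow, h, map_one]) hk
    refine ⟨2 * (τ (ζ n)).re, ?_, ?_⟩
    · rw [map_add, map_inv₀, Complex.inv_eq_conj hnorm, Complex.add_conj]
    · rw [abs_mul, abs_two]
      linarith [Complex.abs_re_le_norm (τ (ζ n))]

/-- A quadratic integer over a conjugate-bounded totally real integer is a Weil number. -/
theorem norm_eq_sqrt_of_sq_sub_mul_add {a : ℂ} {b c : ℝ} (h : a ^ 2 - b * a + c = 0)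
    (hb : b ^ 2 < 4 * c) : ‖a‖ = √c := by
  have hre := congrArg Complex.re h
  have him := congrArg Complex.im h
  simp [sq] at hre him
  -- The negative discriminant makes `a` non-real, so `b` is its trace and `c` its squared norm.
  have hy : a.im ≠ 0 := fun h0 => by
    rw [h0] at hre
    nlinarith [sq_nonneg (2 * a.re - b)]
  have hx : 2 * a.re = b := mul_left_cancel₀ hy (by linarith)
  rw [Complex.norm_def, Complex.normSq_apply]
  congr 1
  rw [← hx] at hre
  linarith
/-! ### Finite-dimensional spaces of functions -/

/-- A minimal subspace cut out by finitely many vanishing conditions must be zero, since any further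
coordinate would shrink it. -/
theorem Submodule.exists_finset_restrict_injective {K I : Type*} [Field K]
    (W : Submodule K (I → K)) [FiniteDimensional K W] :
    ∃ T : Finset I, ∀ w ∈ W, (∀ i ∈ T, w i = 0) → w = 0 := by
  classical
  let P : Finset I → Submodule K W := fun T => ⨅ i ∈ T, LinearMap.ker (LinearMap.proj i ∘ₗ W.subtype)
  have hP : ∀ T w, w ∈ P T ↔ ∀ i ∈ T, (w : I → K) i = 0 := fun T w => by simp [P]
  obtain ⟨_, ⟨T, rfl⟩, hmin⟩ := IsArtinian.set_has_minimal (Set.range P) ⟨_, ∅, rfl⟩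
  refine ⟨T, fun w hw h0 => funext fun i => ?_⟩
  by_contra hi
  refine hmin (P (insert i T)) ⟨_, rfl⟩ (lt_of_le_of_ne (fun v hv => ?_) fun heq => ?_)
  · rw [hP] at hv ⊢
    exact fun j hj => hv j (Finset.mem_insert_of_mem hj)
  · have : (⟨w, hw⟩ : W) ∈ P (insert i T) := by rw [heq, hP]; exact h0
    rw [hP] at this
    exact hi (this i (Finset.mem_insert_self i T))

theorem Submodule.finite_setOf_forall_mem {K I : Type*} [Field K] (W : Submodule K (I → K))
    [FiniteDimensional K W] {A : Set K} (hA : A.Finite) :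
    {w | w ∈ W ∧ ∀ i, w i ∈ A}.Finite := by
  obtain ⟨T, hT⟩ := W.exists_finset_restrict_injective
  refine Set.Finite.of_finite_image (f := fun w (i : T) => w i)
    ((Set.Finite.pi' fun _ : T => hA).subset ?_) ?_
  · rintro _ ⟨w, hw, rfl⟩ i
    exact hw.2 i
  · intro v hv w hw h
    refine sub_eq_zero.1 (hT _ (W.sub_mem hv.1 hw.1) fun i hi => ?_)
    exact sub_eq_zero.2 (congrFun h ⟨i, hi⟩)

theorem AddMonoidHom.aleph0_le_rank_or_finiteDimensional_span {M V K : Type*} [AddCommGroup M]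
    [Field K] [CharZero K] [AddCommGroup V] [Module K V] (f : M →+ V) :
    Cardinal.aleph0 ≤ Module.rank ℤ M ∨ FiniteDimensional K (Submodule.span K (Set.range f)) := by
  obtain ⟨b, hb, hspan, hli⟩ := exists_linearIndependent K (Set.range f)
  rcases b.finite_or_infinite with hfin | hinf
  · right
    rw [← hspan]
    exact FiniteDimensional.span_of_finite K hfin
  · left
    have := hinf.to_subtype
    choose g hg using fun x : b => hb x.2
    have h1 : LinearIndependent ℤ (f.toIntLinearMap ∘ g) := by
      rw [show f.toIntLinearMap ∘ g = ((↑) : b → V) from funext hg]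
      exact hli.restrict_scalars' ℤ
    have h2 := (LinearIndependent.of_comp _ h1).aleph0_le_rank
    exact h2

/-- An infinite family whose images are pairwise distinct functions with values in a fixed
finite set forces infinite rank. -/
theorem AddMonoidHom.aleph0_le_rank_of_infinite_range {M I J K : Type*} [AddCommGroup M]
    [Field K] [CharZero K] (f : M →+ (I → K)) {A : Set K} (hA : A.Finite) [Infinite J] (g : J → M)
    (hg : ∀ j i, f (g j) i ∈ A) (hinj : Function.Injective fun j => f (g j)) :
    Cardinal.aleph0 ≤ Module.rank ℤ M := by
  refine (f.aleph0_le_rank_or_finiteDimensional_span (K := K)).resolve_right fun hfin => ?_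
  refine Set.infinite_range_of_injective hinj
    (((Submodule.span K (Set.range f)).finite_setOf_forall_mem hA).subset ?_)
  rintro _ ⟨j, rfl⟩
  exact ⟨Submodule.subset_span ⟨g j, rfl⟩, hg j⟩

/-! ### Ultrametric sizes of quadratic roots -/

/-- If `‖b‖ > 1` the cube dominates; if `‖b‖ < 1` then `‖c‖ ≤ ‖b‖ < 1`. -/
theorem norm_eq_one_of_norm_cube_sub {K : Type*} [NormedField K] [IsUltrametricDist K] {b c : K}
    (hc : ‖c‖ = 1) (h : b ^ 3 - 3 * b = c) : ‖b‖ = 1 := by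
  have h3 : ‖(3 : K)‖ ≤ 1 := by exact_mod_cast IsUltrametricDist.norm_natCast_le_one K 3
  refine le_antisymm ?_ ?_
  · by_contra! hlt
    have h1 : ‖b‖ ^ 3 ≤ max ‖b‖ 1 := by
      rw [← norm_pow, show b ^ 3 = 3 * b + c by rw [← h]; ring]
      refine (IsUltrametricDist.norm_add_le_max _ _).trans (max_le_max ?_ hc.le)
      rw [norm_mul]
      exact mul_le_of_le_one_left (norm_nonneg b) h3
    rw [max_eq_left hlt.le] at h1
    nlinarith [mul_pos (by linarith : 0 < ‖b‖) (by nlinarith : 0 < ‖b‖ ^ 2 - 1)]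
  · by_contra! hlt
    have h1 : ‖c‖ ≤ ‖b‖ := by
      rw [← h, show b ^ 3 - 3 * b = b * (b ^ 2 - 3) by ring, norm_mul]
      refine mul_le_of_le_one_right (norm_nonneg b) ?_
      rw [sub_eq_add_neg]
      refine (IsUltrametricDist.norm_add_le_max _ _).trans ?_
      rw [norm_neg]
      exact max_le (by rw [norm_pow]; exact pow_le_one₀ (norm_nonneg b) hlt.le) h3
    linarith

theorem norm_eq_one_or_norm_eq_one_of_add {K : Type*} [NormedField K] [IsUltrametricDist K]
    {a a' : K} (hs : ‖a + a'‖ = 1) (hp : ‖a * a'‖ < 1) : ‖a‖ = 1 ∨ ‖a'‖ = 1 := by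
  by_cases h : ‖a‖ = ‖a'‖
  · exfalso
    have h1 := IsUltrametricDist.norm_add_le_max a a'
    rw [hs, h, max_self] at h1
    rw [norm_mul, h] at hp
    nlinarith
  · rw [IsUltrametricDist.norm_add_eq_max_of_norm_ne_norm h] at hs
    rcases max_choice ‖a‖ ‖a'‖ with hm | hm <;> rw [hm] at hs
    exacts [.inl hs, .inr hs]

theorem norm_dichotomy_of_sq_sub_mul_add {K : Type*} [NormedField K] [IsUltrametricDist K]
    {a b c : K} (h : a ^ 2 - b * a + c = 0) (hb : ‖b‖ = 1) (hc : ‖c‖ < 1) :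
    ‖a‖ = 1 ∧ ‖b - a‖ = ‖c‖ ∨ ‖a‖ = ‖c‖ ∧ ‖b - a‖ = 1 := by
  have hp : a * (b - a) = c := by linear_combination -h
  have hpn : ‖a‖ * ‖b - a‖ = ‖c‖ := by rw [← norm_mul, hp]
  rcases norm_eq_one_or_norm_eq_one_of_add (a := a) (a' := b - a)
    (by rwa [add_sub_cancel]) (by rwa [hp]) with h1 | h1
  · exact .inl ⟨h1, by rw [← hpn, h1, one_mul]⟩
  · exact .inr ⟨by rw [← hpn, h1, mul_one], h1⟩

/-! ### Galois elements separating square roots -/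

/-- Otherwise every `σ` over `L` acts on `s` and `t` by the same sign, so it fixes `s * t`. -/
theorem exists_algEquiv_separating_sqrt {F E : Type*} [Field F] [Field E] [Algebra F E]
    [IsGalois F E] {s t a b : E} (hs : s ^ 2 = a) (ht : t ^ 2 = b)
    {L : IntermediateField F E} (ha : a ∈ L) (hb : b ∈ L) (hst : s * t ∉ L) :
    ∃ σ : E ≃ₐ[L] E, σ s = s ∧ σ t = -t ∨ σ s = -s ∧ σ t = t := by
  by_contra! hcon
  apply hst
  have hbot : s * t ∈ (⊥ : IntermediateField L E) := by
    refine (InfiniteGalois.mem_bot_iff_fixed _).2 fun σ => ?_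
    have h1 : σ s = s ∨ σ s = -s := by
      rw [← sq_eq_sq_iff_eq_or_eq_neg, ← map_pow, hs]
      exact σ.commutes ⟨a, ha⟩
    have h2 : σ t = t ∨ σ t = -t := by
      rw [← sq_eq_sq_iff_eq_or_eq_neg, ← map_pow, ht]
      exact σ.commutes ⟨b, hb⟩
    rw [map_mul]
    rcases h1 with h1 | h1 <;> rcases h2 with h2 | h2
    · rw [h1, h2]
    · exact absurd h2 ((hcon σ).1 h1)
    · exact absurd h2 ((hcon σ).2 h1)
    · rw [h1, h2, neg_mul_neg]
  obtain ⟨x, hx⟩ := IntermediateField.mem_bot.1 hbot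
  rw [← hx]
  exact x.2

/-! ### The fields generated by the squares of the tower -/

section Tower

variable {K : Type*} [Field K] {β : ℕ → K}

theorem iterate_sqTripling_tower (h0 : β 0 = 1) (hs : ∀ n, β (n + 1) ^ 3 - 3 * β (n + 1) = β n)
    (n : ℕ) : sqTripling^[n] (β n ^ 2) = 1 := by
  induction n with
  | zero => simp [h0]
  | succ n ih =>
    rw [Function.iterate_succ_apply, sqTripling,
      show β (n + 1) ^ 2 * (β (n + 1) ^ 2 - 3) ^ 2 = β n ^ 2 by rw [← hs n]; ring, ih]

theorem tower_ne_zero (h0 : β 0 = 1) (hs : ∀ n, β (n + 1) ^ 3 - 3 * β (n + 1) = β n)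
    (n : ℕ) : β n ≠ 0 := by
  induction n with
  | zero => simp [h0]
  | succ n ih => exact fun h => ih (by rw [← hs n, h]; ring)

variable [CharZero K]

theorem tower_sq_mem_adjoin (hs : ∀ n, β (n + 1) ^ 3 - 3 * β (n + 1) = β n) {n m : ℕ}
    (h : n ≤ m) : β n ^ 2 ∈ ℚ⟮β m ^ 2⟯ := by
  induction h using Nat.decreasingInduction with
  | self => exact mem_adjoin_simple_self ℚ _
  | of_succ k _ ih =>
    rw [show β k ^ 2 = β (k + 1) ^ 2 * (β (k + 1) ^ 2 - 3) ^ 2 by rw [← hs k]; ring]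
    exact mul_mem ih (pow_mem (sub_mem ih (ofNat_mem _ 3)) 2)

/-- The tripling cubic is odd, so `β (n + 1)` is `β n` divided by `β (n + 1) ^ 2 - 3`; the square
alone generates everything below. -/
theorem tower_mem_adjoin (h0 : β 0 = 1) (hs : ∀ n, β (n + 1) ^ 3 - 3 * β (n + 1) = β n) {n m : ℕ}
    (h : n ≤ m) : β n ∈ ℚ⟮β m ^ 2⟯ := by
  induction n with
  | zero => rw [h0]; exact one_mem _
  | succ n ih =>
    have h1 : β (n + 1) * (β (n + 1) ^ 2 - 3) = β n := by rw [← hs n]; ring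
    have h2 : β (n + 1) ^ 2 - 3 ≠ 0 := fun h2 => tower_ne_zero h0 hs n (by rw [← h1, h2, mul_zero])
    rw [eq_div_of_mul_eq h2 h1]
    exact div_mem (ih (by omega)) (sub_mem (tower_sq_mem_adjoin hs h) (ofNat_mem _ 3))

theorem odd_finrank_adjoin_tower (h0 : β 0 = 1)
    (hs : ∀ n, β (n + 1) ^ 3 - 3 * β (n + 1) = β n) (n : ℕ) :
    Odd (Module.finrank ℚ ℚ⟮β n ^ 2⟯) := by
  have hmin := minpoly_of_iterate_sqTripling_eq_one (iterate_sqTripling_tower h0 hs n)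
  have hint : IsIntegral ℚ (β n ^ 2) := by
    rw [← minpoly.ne_zero_iff, hmin]
    exact ((monic_orbitPoly n).map _).ne_zero
  rw [adjoin.finrank hint, hmin, (monic_orbitPoly n).natDegree_map, natDegree_orbitPoly]
  exact Odd.pow (by decide)

theorem isSquare_of_mul_mem_adjoin_tower (h0 : β 0 = 1)
    (hs : ∀ n, β (n + 1) ^ 3 - 3 * β (n + 1) = β n) {n m : ℕ} (hnm : n ≤ m) {a : ℤ} (ha : 8 ≤ a)
    {s t : K} (hn : s ^ 2 = β n ^ 2 - a) (hm : t ^ 2 = β m ^ 2 - a) (hst : s * t ∈ ℚ⟮β m ^ 2⟯) :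
    IsSquare ((sqTripling^[n] a - 1) * (sqTripling^[m] a - 1)) := by
  let v := algebraMap ℚ⟮β m ^ 2⟯ K
  have hit : ∀ k, ∀ hk : β k ^ 2 ∈ ℚ⟮β m ^ 2⟯,
      sqTripling^[k] (⟨β k ^ 2, hk⟩ : ℚ⟮β m ^ 2⟯) = 1 := fun k hk => by
    apply v.injective
    rw [map_iterate_sqTripling, map_one]
    exact iterate_sqTripling_tower h0 hs k
  refine isSquare_mul_of_isSquare_mul_sub (odd_finrank_adjoin_tower h0 hs m)
    (hit n (tower_sq_mem_adjoin hs hnm)) (hit m (tower_sq_mem_adjoin hs le_rfl)) ha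
    ⟨⟨s * t, hst⟩, ?_⟩
  apply v.injective
  have e : ∀ k, ∀ hk : β k ^ 2 ∈ ℚ⟮β m ^ 2⟯, v (⟨β k ^ 2, hk⟩) = β k ^ 2 := fun _ _ => rfl
  have e' : v ⟨s * t, hst⟩ = s * t := rfl
  rw [map_mul, map_mul, map_sub, map_sub, e, e, e']
  simp only [map_intCast]
  linear_combination (-(s ^ 2)) * hm - (β m ^ 2 - a) * hn

end Tower

/-! ### Assembly over the algebraic closure of `ℚ` -/

theorem isAlgebraic_rat_algebraicClosure :
    Algebra.IsAlgebraic ℚ (AlgebraicClosure ℚ) := by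
  have h : (DivisionRing.toRatAlgebra : Algebra ℚ (AlgebraicClosure ℚ)) =
      AlgebraicClosure.instAlgebra ℚ := Subsingleton.elim _ _
  rw [h]
  exact AlgebraicClosure.isAlgebraic ℚ

theorem isGalois_rat_algebraicClosure : IsGalois ℚ (AlgebraicClosure ℚ) := by
  have := isAlgebraic_rat_algebraicClosure
  have : IsAlgClosure ℚ (AlgebraicClosure ℚ) := ⟨inferInstance, inferInstance⟩
  have : Normal ℚ (AlgebraicClosure ℚ) := IsAlgClosure.normal ℚ _
  exact ⟨⟩

theorem mainTheorem12 (q : ℕ) (hq : IsPrimePow q) :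
    Cardinal.aleph0 ≤ Module.rank ℤ (Additive (weilSubgroup q 1)) := by
  obtain ⟨p, r, hp, hr, hpq⟩ := (isPrimePow_nat_iff _).1 hq
  have : Fact p.Prime := ⟨hp⟩
  have := isAlgebraic_rat_algebraicClosure
  have := isGalois_rat_algebraicClosure
  have hq2 : 2 ≤ q := hq.two_le
  obtain ⟨β, h0, hs, hint, hreal⟩ := exists_tripling_tower (AlgebraicClosure ℚ)
  have hroot : ∀ n, ∃ a : AlgebraicClosure ℚ, a ^ 2 - β n * a + q = 0 := fun n => by
    obtain ⟨a, ha⟩ := IsAlgClosed.exists_root (C 1 * X ^ 2 + C (-β n) * X + C (q : AlgebraicClosure ℚ))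
      (by rw [degree_quadratic one_ne_zero]; decide)
    exact ⟨a, by simpa [sub_eq_add_neg] using ha⟩
  choose α hα using hroot
  have hαweil : ∀ n, IsWeilNumber q 1 (α n) := fun n => by
    refine ⟨?_, fun τ => ?_⟩
    · have hB : IsIntegral (integralClosure ℤ (AlgebraicClosure ℚ)) (α n) := by
        refine ⟨C 1 * X ^ 2 + C (-⟨β n, hint n⟩) * X + C (q : integralClosure ℤ (AlgebraicClosure ℚ)),
          leadingCoeff_quadratic one_ne_zero, ?_⟩
        simpa [eval₂_add, eval₂_mul, sub_eq_add_neg] using hα n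
      exact isIntegral_trans _ hB
    · obtain ⟨b, hb, hb2⟩ := hreal n τ
      have h := congrArg τ (hα n)
      simp only [map_add, map_sub, map_mul, map_pow, map_natCast, map_zero, hb] at h
      have hq' : (2 : ℝ) ≤ q := by exact_mod_cast hq2
      rw [norm_eq_sqrt_of_sq_sub_mul_add (c := q) (by exact_mod_cast h)
        (by nlinarith [abs_le.1 hb2]), Real.sqrt_eq_rpow]
      norm_num
  have hα0 : ∀ n, α n ≠ 0 := fun n h => by
    have := hα n
    rw [h] at this
    have : (q : AlgebraicClosure ℚ) = 0 := by simpa using this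
    exact (by omega : q ≠ 0) (by exact_mod_cast this)
  let ι : AlgebraicClosure ℚ →+* PadicAlgCl p :=
    (IsAlgClosed.lift : AlgebraicClosure ℚ →ₐ[ℚ] PadicAlgCl p).toRingHom
  have hqlt : ‖(q : PadicAlgCl p)‖ < 1 := by
    have h : ‖(p : PadicAlgCl p)‖ = ‖(p : ℚ_[p])‖ := by
      rw [← PadicAlgCl.norm_extends]
      simp
    rw [← hpq, Nat.cast_pow, norm_pow, h]
    exact pow_lt_one₀ (norm_nonneg _) Padic.norm_p_lt_one hr.ne'
  have hβ1 : ∀ (σ : AlgebraicClosure ℚ ≃ₐ[ℚ] AlgebraicClosure ℚ) n, ‖ι (σ (β n))‖ = 1 :=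
    fun σ n => by
      induction n with
      | zero => simp [h0]
      | succ n ih =>
        refine norm_eq_one_of_norm_cube_sub ih ?_
        rw [← hs n]
        simp only [map_sub, map_pow, map_mul, map_ofNat]
  have hdich : ∀ (σ : AlgebraicClosure ℚ ≃ₐ[ℚ] AlgebraicClosure ℚ) n,
      ‖ι (σ (α n))‖ = 1 ∧ ‖ι (σ (β n - α n))‖ = ‖(q : PadicAlgCl p)‖ ∨
      ‖ι (σ (α n))‖ = ‖(q : PadicAlgCl p)‖ ∧ ‖ι (σ (β n - α n))‖ = 1 := fun σ n => by
    have h := congrArg (fun x => ι (σ x)) (hα n)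
    simp only [map_add, map_sub, map_mul, map_pow, map_natCast, map_zero] at h
    have := norm_dichotomy_of_sq_sub_mul_add h (hβ1 σ n) hqlt
    simpa only [map_sub] using this
  let f : Additive (weilSubgroup q 1) →+
      ((AlgebraicClosure ℚ ≃ₐ[ℚ] AlgebraicClosure ℚ) → ℝ) :=
    { toFun := fun u σ => Real.log ‖ι (σ ((u.toMul : (AlgebraicClosure ℚ)ˣ) : AlgebraicClosure ℚ))‖
      map_zero' := by ext; simp
      map_add' := fun u v => by
        ext σ
        simp only [toMul_add, Subgroup.coe_mul, Units.val_mul, map_mul, norm_mul, Pi.add_apply]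
        exact Real.log_mul (by simp) (by simp) }
  obtain ⟨S, hSinf, hS⟩ := exists_infinite_not_isSquare_mul (q := q) (by exact_mod_cast hq2)
  have := hSinf.to_subtype
  let g : S → Additive (weilSubgroup q 1) := fun n =>
    Additive.ofMul ⟨Units.mk0 (α n) (hα0 n), Subgroup.subset_closure (hαweil n)⟩
  have hfg : ∀ n σ, f (g n) σ = Real.log ‖ι (σ (α n))‖ := fun _ _ => rfl
  refine f.aleph0_le_rank_of_infinite_range (A := {0, Real.log ‖(q : PadicAlgCl p)‖})
    (Set.toFinite _) g (fun n σ => ?_) ?_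
  · rw [hfg]
    rcases hdich σ n with h | h <;> simp [h.1]
  have key : ∀ n m : S, (n : ℕ) < m → f (g n) ≠ f (g m) := fun n m hnm heq => by
    -- A square root of the discriminant of the quadratic of `α k`; flipping its sign exchanges `α
    -- k` with `β k - α k`.
    let s : ℕ → AlgebraicClosure ℚ := fun k => 2 * α k - β k
    have hs2 : ∀ k, s k ^ 2 = β k ^ 2 - ((4 * q : ℤ) : AlgebraicClosure ℚ) := fun k => by
      push_cast
      linear_combination 4 * hα k
    have hst : s n * s m ∉ ℚ⟮β m ^ 2⟯ := fun h =>
      hS n n.2 m m.2 hnm (isSquare_of_mul_mem_adjoin_tower h0 hs hnm.le (by omega)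
        (hs2 n) (hs2 m) h)
    have hmem : ∀ k ≤ (m : ℕ), β k ^ 2 - ((4 * q : ℤ) : AlgebraicClosure ℚ) ∈ ℚ⟮β m ^ 2⟯ :=
      fun k hk => sub_mem (tower_sq_mem_adjoin hs hk) (intCast_mem _ _)
    obtain ⟨σ, hσ⟩ := exists_algEquiv_separating_sqrt (hs2 n) (hs2 m) (hmem n hnm.le)
      (hmem m le_rfl) hst
    have hσβ : ∀ k ≤ (m : ℕ), σ (β k) = β k := fun k hk =>
      σ.commutes ⟨β k, tower_mem_adjoin h0 hs hk⟩
    have hfix : ∀ k ≤ (m : ℕ), σ (s k) = s k → σ (α k) = α k := fun k hk h => by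
      simp only [s, map_sub, map_mul, map_ofNat, hσβ k hk] at h
      linear_combination h / 2
    have hflip : ∀ k ≤ (m : ℕ), σ (s k) = -s k → σ (α k) = β k - α k := fun k hk h => by
      simp only [s, map_sub, map_mul, map_ofNat, hσβ k hk] at h
      linear_combination h / 2
    have hval : ∀ τ : AlgebraicClosure ℚ ≃ₐ[ℚ] AlgebraicClosure ℚ, ‖ι (τ (α n))‖ = ‖ι (τ (α m))‖ := fun τ => by
      have h := congrFun heq τ
      rw [hfg, hfg] at h
      exact Real.log_injOn_pos (by simp [hα0]) (by simp [hα0]) h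
    have hv1 := hval AlgEquiv.refl
    have hvσ := hval (σ.restrictScalars ℚ)
    have hdn := hdich AlgEquiv.refl n
    have hdm := hdich AlgEquiv.refl m
    simp only [AlgEquiv.coe_refl, id_eq, AlgEquiv.restrictScalars_apply] at hv1 hvσ hdn hdm
    rcases hσ with ⟨h1, h2⟩ | ⟨h1, h2⟩
    -- One root is fixed and the other exchanged with its partner, so equal functions would force
    -- `‖q‖ = 1`.
    · rw [hfix n hnm.le h1, hflip m le_rfl h2, hv1] at hvσ
      rcases hdm with ⟨e1, e2⟩ | ⟨e1, e2⟩ <;> rw [e1, e2] at hvσ <;> linarith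
    · rw [hflip n hnm.le h1, hfix m le_rfl h2, ← hv1] at hvσ
      rcases hdn with ⟨e1, e2⟩ | ⟨e1, e2⟩ <;> rw [e1, e2] at hvσ <;> linarith
  intro n m heq
  rcases lt_trichotomy (n : ℕ) m with h | h | h
  exacts [absurd heq (key n m h), Subtype.ext h, absurd heq.symm (key m n h)]
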